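/- Let $G$ be a finite soluble group. A Sylow basis of $G$ is a family of Sylow subgroups of $G$, exactly one Sylow $p$-subgroup $P_p$ for each prime divisor $p$ of $|G|$, such that $P_pP_q=P_qP_p$ for all $p,q$. A subgroup $T$ of $G$ is a system normalizer in $G$ if $T=\bigcap_{p} N_G(P_p)$ for some Sylow basis $(P_p)_p$ of $G$ (for $|G|=1$ the empty intersection is $G$). For $x\in G$ write $x^G$ for the conjugacy class of $x$ in $G$, and let $G'$ be the derived group of $G$. There is a function $f\colon\mathbb N\to\mathbb N$ such that the following holds. Let $n$ be a positive integer and let $G$ be a finite soluble group having a system normalizer $T$ such that $|x^G|\le n$ for each $x\in T$. Then $|G'|\le f(n)$. -/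

import Mathlib

open scoped Pointwise

/-- A Sylow basis of `G`: one Sylow `p`-subgroup for each prime divisor `p` of the order of `G`,
any two of which permute, that is, `P Q = Q P` as subsets of `G`. -/
structure SylowBasis (G : Type*) [Group G] where
  /-- The member of the basis belonging to the prime divisor `p`. -/
  sylow : ∀ p : (Nat.card G).primeFactors, Sylow (p : ℕ) G
  permutable : ∀ p q : (Nat.card G).primeFactors,
    (sylow p : Set G) * (sylow q : Set G) = (sylow q : Set G) * (sylow p : Set G)

/-- The intersection of the normalizers in `G` of the members of a Sylow basis. -/
def SylowBasis.systemNormalizer {G : Type*} [Group G] (B : SylowBasis G) : Subgroup G :=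
  ⨅ p : (Nat.card G).primeFactors, Subgroup.normalizer (B.sylow p : Set G)

/-- `T` is a system normalizer in `G`: the system normalizer of some Sylow basis of `G`. -/
def IsSystemNormalizer {G : Type*} [Group G] (T : Subgroup G) : Prop :=
  ∃ B : SylowBasis G, T = B.systemNormalizer

/-!
Two facts give the theorem.

The normal closure of a system normalizer `T` of a finite solvable group `G` is `G`
(`SylowBasis.normalClosure_systemNormalizer`). Otherwise some proper normal subgroup `M` contains
both `T` and the Hall `p'`-subgroup `Q` which is the product of the members `P_q`, `q ≠ p`, of the
Sylow basis. A Frattini argument (`not_normalizer_le_of_hall`) shows that the normalizer of `Q` is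
not contained in `M`. Since `G = Q P_p`, it has an element outside `M` which lies in `P_p`; this
element normalizes every `P_q = Q ∩ P_q P_p`, and so lies in `T`, a contradiction.

If `K` is a subgroup with normal closure `G` all of whose elements have at most `n` conjugates in
`G`, then `|G'|` is bounded in terms of `n` (`card_commutator_le_of_normalClosure_eq_top`). This
extends Neumann's theorem on groups with bounded conjugacy classes. For `a ∈ K` the normal subgroup
`[G, a]` generated by the commutators `⁅g, a⁆` has bounded order (`card_commutatorWith_le`): its
derived group is bounded by Schur's theorem, and after factoring it and then `[[G, a], a]` out,
`[G, a]` is abelian with a bounded number of generators and bounded exponent. Now choose `a ∈ K`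
with the largest class, and a bounded number of conjugates of elements of `K` that generate a
subgroup transitive on this class. If `u ∈ K` centralizes them, then `[G, u] ≤ [G, a]`
(`commutator_mem_commutatorWith_of_centralizes`). Such `u` form a subgroup of bounded index in `K`,
so `[G, K]`, which is `G'`, is a product of boundedly many of the subgroups `[G, k]`.
-/

/-! ### Commutators with a fixed element -/

section CommutatorsWith

open scoped commutatorElement

variable {G : Type*} [Group G]

theorem conjugatesOf_eq_range (a : G) : conjugatesOf a = Set.range fun g => g * a * g⁻¹ := by
  ext y
  simp [conjugatesOf, isConj_iff]

theorem index_centralizer_singleton (a : G) :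
    (Subgroup.centralizer {a}).index = (conjugatesOf a).ncard := by
  have h : Nat.card (G ⧸ Subgroup.centralizer {a}) = Nat.card (conjugatesOf a) := by
    rw [conjugatesOf_eq_range]
    refine Nat.card_congr (Equiv.ofBijective
      (Quotient.lift (fun g => (⟨g * a * g⁻¹, g, rfl⟩ : Set.range fun g => g * a * g⁻¹)) ?_)
      ⟨?_, ?_⟩)
    · intro g h hgh
      have := Subgroup.mem_centralizer_singleton_iff.1 (QuotientGroup.leftRel_apply.1 hgh)
      refine Subtype.ext ?_
      change g * a * g⁻¹ = h * a * h⁻¹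
      rw [show h = g * (g⁻¹ * h) by group, show g * (g⁻¹ * h) * a * (g * (g⁻¹ * h))⁻¹ =
        g * ((g⁻¹ * h) * a * (g⁻¹ * h)⁻¹) * g⁻¹ by group, this]
      group
    · rintro ⟨g⟩ ⟨h⟩ hgh
      refine Quotient.sound (QuotientGroup.leftRel_apply.2
        (Subgroup.mem_centralizer_singleton_iff.2 ?_))
      have h1 : g * a * g⁻¹ = h * a * h⁻¹ := congrArg Subtype.val hgh
      calc g⁻¹ * h * a = g⁻¹ * (h * a * h⁻¹) * h := by group
        _ = a * (g⁻¹ * h) := by rw [← h1]; group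
    · rintro ⟨_, g, rfl⟩
      exact ⟨(g : G ⧸ Subgroup.centralizer {a}), rfl⟩
  rw [Subgroup.index, h, Nat.card_coe_set_eq]

theorem ncard_conjugatesOf_map_le [Finite G] {H : Type*} [Group H] {f : G →* H}
    (hf : Function.Surjective f) (a : G) :
    (conjugatesOf (f a)).ncard ≤ (conjugatesOf a).ncard := by
  have h : conjugatesOf (f a) = f '' conjugatesOf a := by
    rw [conjugatesOf_eq_range, conjugatesOf_eq_range, ← Set.range_comp, ← hf.range_comp]
    congr 1
    ext g
    simp
  rw [h]
  exact Set.ncard_image_le (Set.toFinite _)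

theorem ncard_range_commutator (a : G) :
    (Set.range fun g : G => ⁅g, a⁆).ncard = (conjugatesOf a).ncard := by
  rw [conjugatesOf_eq_range]
  have h : (Set.range fun g : G => ⁅g, a⁆) = (· * a⁻¹) '' Set.range fun g => g * a * g⁻¹ := by
    rw [← Set.range_comp]
    rfl
  rw [h, Set.ncard_image_of_injective _ (mul_left_injective a⁻¹)]

/-- The subgroup `[G, a]` generated by the commutators `⁅g, a⁆` with `a` fixed. It is normal,
and coincides with the commutator of `G` with the normal closure of `a`. -/
def commutatorWith (a : G) : Subgroup G :=
  Subgroup.closure (Set.range fun g : G => ⁅g, a⁆)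

theorem commutator_mem_commutatorWith (g a : G) : ⁅g, a⁆ ∈ commutatorWith a :=
  Subgroup.subset_closure ⟨g, rfl⟩

instance commutatorWith_normal (a : G) : (commutatorWith a).Normal := by
  refine ⟨fun x hx g => ?_⟩
  induction hx using Subgroup.closure_induction with
  | mem y hy =>
    obtain ⟨h, rfl⟩ := hy
    have : g * ⁅h, a⁆ * g⁻¹ = ⁅g * h, a⁆ * ⁅g, a⁆⁻¹ := by
      simp only [commutatorElement_def]; group
    change g * ⁅h, a⁆ * g⁻¹ ∈ _
    rw [this]
    exact mul_mem (commutator_mem_commutatorWith _ _)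
      (inv_mem (commutator_mem_commutatorWith _ _))
  | one => simp
  | mul y z _ _ hy hz => simpa only [conj_mul] using mul_mem hy hz
  | inv y _ hy => simpa only [conj_inv] using inv_mem hy

theorem map_commutatorWith {H : Type*} [Group H] {f : G →* H} (hf : Function.Surjective f)
    (a : G) : (commutatorWith a).map f = commutatorWith (f a) := by
  rw [commutatorWith, commutatorWith, MonoidHom.map_closure, ← Set.range_comp, ← hf.range_comp]
  congr 2
  ext g
  simp [commutatorElement_def]

theorem card_eq_card_mul_card_map_mk {D N : Subgroup G} [D.Normal] (h : D ≤ N) :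
    Nat.card N = Nat.card D * Nat.card (N.map (QuotientGroup.mk' D)) := by
  rw [← Subgroup.relIndex_ker, QuotientGroup.ker_mk', ← Subgroup.relIndex_bot_left D,
    ← Subgroup.relIndex_bot_left N, Subgroup.relIndex_mul_relIndex _ _ _ bot_le h]

theorem card_sup_le_of_normal [Finite G] (H D : Subgroup G) [D.Normal] :
    Nat.card (H ⊔ D : Subgroup G) ≤ Nat.card H * Nat.card D := by
  rw [← Subgroup.relIndex_bot_left (H ⊔ D),
    ← Subgroup.relIndex_mul_relIndex ⊥ D (H ⊔ D) bot_le le_sup_right,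
    Subgroup.relIndex_sup_right, Subgroup.relIndex_bot_left, mul_comm]
  refine Nat.mul_le_mul_right _ (Nat.le_of_dvd Nat.card_pos ?_)
  rw [← Subgroup.relIndex_bot_left H]
  exact Subgroup.relIndex_dvd_of_le_left _ bot_le

/-- If `a` commutes with `⁅x, a⁆`, then `⁅x, a⁆ ^ k = ⁅x, a ^ k⁆` is determined by the conjugate of
`x` by `a ^ k`, so `⁅x, a⁆` has order at most `|x ^ G|`. -/
theorem orderOf_commutator_le [Finite G] {a x : G}
    (hc : Commute ⁅x, a⁆ a) : orderOf ⁅x, a⁆ ≤ (conjugatesOf x).ncard := by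
  have hpow : ∀ k : ℕ, ⁅x, a⁆ ^ k = x * (a ^ k * x * (a ^ k)⁻¹)⁻¹ := by
    intro k
    have h1 : x * a * x⁻¹ = ⁅x, a⁆ * a := by simp [commutatorElement_def]
    have h2 : x * a ^ k * x⁻¹ = ⁅x, a⁆ ^ k * a ^ k := by
      rw [← conj_pow, h1, hc.mul_pow]
    rw [eq_mul_inv_of_mul_eq h2.symm]
    group
  rw [← Nat.card_zpowers, ← SetLike.coe_sort_coe, Nat.card_coe_set_eq]
  have hsub : (Subgroup.zpowers ⁅x, a⁆ : Set G) ⊆ (fun y => x * y⁻¹) '' conjugatesOf x := by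
    intro y hy
    obtain ⟨k, rfl⟩ := mem_powers_iff_mem_zpowers.2 hy
    refine ⟨a ^ k * x * (a ^ k)⁻¹, ?_, (hpow k).symm⟩
    rw [conjugatesOf_eq_range]
    exact ⟨a ^ k, rfl⟩
  exact (Set.ncard_le_ncard hsub (Set.toFinite _)).trans (Set.ncard_image_le (Set.toFinite _))

end CommutatorsWith

/-! ### Bounding the commutators with a fixed element -/

section CommutatorsWithBound

open scoped commutatorElement Nat

variable {G : Type*} [Group G]

theorem commutator_eq_of_center_coset {x x' y y' : G} (hx : x⁻¹ * x' ∈ Subgroup.center G)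
    (hy : y⁻¹ * y' ∈ Subgroup.center G) : ⁅x, y⁆ = ⁅x', y'⁆ := by
  obtain ⟨z, rfl⟩ : ∃ z, x' = x * z := ⟨x⁻¹ * x', by group⟩
  obtain ⟨w, rfl⟩ : ∃ w, y' = y * w := ⟨y⁻¹ * y', by group⟩
  rw [inv_mul_cancel_left, Subgroup.mem_center_iff] at hx hy
  have h : x * z * (y * w) = x * y * (z * w) := by
    rw [mul_assoc, ← mul_assoc z, ← hx y]; group
  have h' : y * w * (x * z) = y * x * (z * w) := by
    rw [mul_assoc, ← mul_assoc w, ← hy x, mul_assoc x w z, hx w]; group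
  have h'' : ⁅x * z, y * w⁆ = x * z * (y * w) * (y * w * (x * z))⁻¹ := by
    simp only [commutatorElement_def]; group
  rw [h'', h, h', commutatorElement_def]
  group

variable [Finite G]

theorem relIndex_le_index (H K : Subgroup G) : H.relIndex K ≤ H.index := by
  have h : H.relIndex ⊤ ≠ 0 := by
    rw [Subgroup.relIndex_top_right]
    exact Subgroup.index_ne_zero_of_finite
  exact (Subgroup.relIndex_le_of_le_right le_top h).trans_eq H.relIndex_top_right

theorem index_centralizer_closure_le {m k : ℕ} (hm : 0 < m) {S : Set G} (hS : S.ncard ≤ k)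
    (h : ∀ s ∈ S, (conjugatesOf s).ncard ≤ m) :
    (Subgroup.centralizer (Subgroup.closure S : Set G)).index ≤ m ^ k := by
  classical
  have := Fintype.ofFinite S
  have hle : (⨅ s : S, Subgroup.centralizer {(s : G)}) ≤
      Subgroup.centralizer (Subgroup.closure S : Set G) := by
    rw [Subgroup.centralizer_closure]
    intro g hg s hs
    exact (Subgroup.mem_centralizer_singleton_iff.1 (Subgroup.mem_iInf.1 hg ⟨s, hs⟩)).symm
  calc _ ≤ (⨅ s : S, Subgroup.centralizer {(s : G)}).index :=
        Subgroup.index_antitone hle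
    _ ≤ ∏ s : S, (Subgroup.centralizer {(s : G)}).index := Subgroup.index_iInf_le _
    _ ≤ ∏ _s : S, m := Finset.prod_le_prod' fun s _ => by
        rw [index_centralizer_singleton]; exact h s s.2
    _ = m ^ S.ncard := by
        rw [Finset.prod_const, Finset.card_univ, ← Nat.card_eq_fintype_card, Nat.card_coe_set_eq]
    _ ≤ m ^ k := Nat.pow_le_pow_right hm hS

theorem ncard_conjugatesOf_commutator_le (g a : G) :
    (conjugatesOf ⁅g, a⁆).ncard ≤ (conjugatesOf a).ncard * (conjugatesOf a).ncard := by
  have h : (conjugatesOf (g * a * g⁻¹)).ncard = (conjugatesOf a).ncard := by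
    rw [(isConj_iff.2 ⟨g, rfl⟩ : IsConj a (g * a * g⁻¹)).conjugatesOf_eq]
  nth_rw 1 [← h]
  simp only [← index_centralizer_singleton]
  refine le_trans (Subgroup.index_antitone ?_) (Subgroup.index_inf_le (H := Subgroup.centralizer _))
  rintro x ⟨h1, h2⟩
  have h1 : Commute x (g * a * g⁻¹) := Subgroup.mem_centralizer_singleton_iff.1 h1
  have h2 : Commute x a := Subgroup.mem_centralizer_singleton_iff.1 h2
  exact Subgroup.mem_centralizer_singleton_iff.2 (h1.mul_right h2.inv_right)

theorem card_commutatorSet_le :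
    Nat.card (commutatorSet G) ≤ (Subgroup.center G).index * (Subgroup.center G).index := by
  rw [Subgroup.index, ← Nat.card_prod]
  refine Nat.card_le_card_of_surjective (fun p : (G ⧸ Subgroup.center G) × (G ⧸ Subgroup.center G)
    => (⟨⁅p.1.out, p.2.out⁆, commutator_mem_commutatorSet _ _⟩ : commutatorSet G)) ?_
  rintro ⟨_, x, y, rfl⟩
  refine ⟨(x, y), Subtype.ext (commutator_eq_of_center_coset ?_ ?_)⟩ <;>
  · rw [← QuotientGroup.eq]
    exact Quotient.out_eq' _

/-- Schur's theorem, with a bound depending only on the index of the center. -/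
theorem card_commutator_le_of_index_center_le {i : ℕ} (h : (Subgroup.center G).index ≤ i) :
    Nat.card (commutator G) ≤ i ^ (i * (i * i) + 1) := by
  have hpos : 0 < (Subgroup.center G).index := Nat.pos_of_ne_zero Subgroup.index_ne_zero_of_finite
  have h1 := Nat.le_of_dvd (pow_pos hpos _) (Subgroup.card_commutator_dvd_index_center_pow G)
  refine h1.trans ((Nat.pow_le_pow_left h _).trans (Nat.pow_le_pow_right (hpos.trans_le h) ?_))
  exact Nat.succ_le_succ (Nat.mul_le_mul h (card_commutatorSet_le.trans (Nat.mul_le_mul h h)))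

/-- The case where `[G, a]` is abelian and centralized by `a`: then `[G, a]` has exponent dividing
`n !`, because `⁅g, a⁆` is a product of conjugates of commutators `⁅x, a⁆` with `x ∈ X`. -/
theorem card_commutatorWith_le_of_commute {n : ℕ} {X : Set G} (hX : Subgroup.closure X = ⊤)
    (hXn : ∀ x ∈ X, (conjugatesOf x).ncard ≤ n) {a : G} (ha : (conjugatesOf a).ncard ≤ n)
    (hN : ∀ y ∈ commutatorWith a, ∀ z ∈ commutatorWith a, Commute y z)
    (hNa : ∀ y ∈ commutatorWith a, Commute y a) :
    Nat.card (commutatorWith a) ≤ n ! ^ n := by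
  have hexp : ∀ g : G, ⁅g, a⁆ ^ n ! = 1 := by
    intro g
    induction (hX ▸ Subgroup.mem_top g : g ∈ Subgroup.closure X) using
      Subgroup.closure_induction with
    | mem x hx =>
      have hc := hNa _ (commutator_mem_commutatorWith x a)
      exact orderOf_dvd_iff_pow_eq_one.1 (Nat.dvd_factorial (orderOf_pos _)
        ((orderOf_commutator_le hc).trans (hXn x hx)))
    | one => simp
    | mul x y _ _ hx hy =>
      have h : ⁅x * y, a⁆ = x * ⁅y, a⁆ * x⁻¹ * ⁅x, a⁆ := by
        simp only [commutatorElement_def]; group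
      have h1 := hN _ ((commutatorWith_normal a).conj_mem _ (commutator_mem_commutatorWith y a) x)
        _ (commutator_mem_commutatorWith x a)
      rw [h, h1.mul_pow, conj_pow, hx, hy]
      simp
    | inv x _ hx =>
      have h : ⁅x⁻¹, a⁆ = x⁻¹ * ⁅x, a⁆⁻¹ * x⁻¹⁻¹ := by
        simp only [commutatorElement_def]; group
      rw [h, conj_pow, inv_pow, hx]
      simp
  let _ : CommGroup (commutatorWith a) :=
    { mul_comm := fun x y => Subtype.ext (hN x x.2 y y.2) }
  have hexp' : ∀ y : commutatorWith a, y ^ n ! = 1 := by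
    rintro ⟨y, hy⟩
    refine Subtype.ext ?_
    change y ^ n ! = 1
    have hy' := hy
    rw [commutatorWith] at hy'
    induction hy' using Subgroup.closure_induction with
    | mem x hx => obtain ⟨g, rfl⟩ := hx; exact hexp g
    | one => simp
    | mul x z hx hz h1 h2 => rw [(hN x hx z hz).mul_pow, h1 hx, h2 hz, one_mul]
    | inv x hx h1 => rw [inv_pow, h1 hx, inv_one]
  refine (Nat.le_of_dvd (by positivity) (card_dvd_exponent_pow_rank' _ hexp')).trans
    (Nat.pow_le_pow_right (Nat.factorial_pos n) ?_)
  refine (Subgroup.rank_closure_finite_le_nat_card _).trans ?_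
  rw [Nat.card_coe_set_eq, ncard_range_commutator]
  exact ha

/-- The case where `[G, a]` is abelian. The commutators `⁅y, a⁆` with `y ∈ [G, a]` then form a
normal subgroup of order at most `|a ^ G|`, modulo which `a` centralizes `[G, a]`. -/
theorem card_commutatorWith_le_of_comm {n : ℕ} {X : Set G} (hX : Subgroup.closure X = ⊤)
    (hXn : ∀ x ∈ X, (conjugatesOf x).ncard ≤ n) {a : G} (ha : (conjugatesOf a).ncard ≤ n)
    (hN : ∀ y ∈ commutatorWith a, ∀ z ∈ commutatorWith a, Commute y z) :
    Nat.card (commutatorWith a) ≤ n * n ! ^ n := by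
  have hmul : ∀ x y, y ∈ commutatorWith a → x ∈ commutatorWith a →
      ⁅x * y, a⁆ = ⁅x, a⁆ * ⁅y, a⁆ := by
    intro x y _ hx
    have h : ⁅x * y, a⁆ = x * ⁅y, a⁆ * x⁻¹ * ⁅x, a⁆ := by
      simp only [commutatorElement_def]; group
    rw [h, (hN _ hx _ (commutator_mem_commutatorWith y a)).eq, mul_inv_cancel_right,
      (hN _ (commutator_mem_commutatorWith y a) _ (commutator_mem_commutatorWith x a)).eq]
  let D : Subgroup G :=
    ((MonoidHom.mk' (fun y : commutatorWith a => ⁅(y : G), a⁆)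
      fun x y => hmul x y y.2 x.2) : commutatorWith a →* G).range
  have hD : ∀ y, y ∈ D ↔ ∃ x ∈ commutatorWith a, ⁅x, a⁆ = y := by
    intro y
    constructor
    · rintro ⟨x, rfl⟩; exact ⟨x, x.2, rfl⟩
    · rintro ⟨x, hx, rfl⟩; exact ⟨⟨x, hx⟩, rfl⟩
  have hDle : D ≤ commutatorWith a := by
    intro y hy
    obtain ⟨x, -, rfl⟩ := (hD y).1 hy
    exact commutator_mem_commutatorWith x a
  have : D.Normal := by
    refine ⟨fun y hy g => ?_⟩
    obtain ⟨x, hx, rfl⟩ := (hD y).1 hy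
    have hx' := (commutatorWith_normal a).conj_mem _ hx g
    refine (hD _).2 ⟨g * x * g⁻¹, hx', ?_⟩
    have h1 : g * ⁅x, a⁆ * g⁻¹ = g * x * g⁻¹ * ⁅g, a⁆ *
        (⁅g * x * g⁻¹, a⁆⁻¹ * (g * x * g⁻¹))⁻¹ * ⁅g, a⁆⁻¹ := by
      simp only [commutatorElement_def]; group
    have hga := commutator_mem_commutatorWith g a
    have hxa := commutator_mem_commutatorWith (g * x * g⁻¹) a
    rw [h1, (hN _ hx' _ hga).eq, mul_inv_rev, inv_inv, mul_assoc ⁅g, a⁆, mul_inv_cancel_left,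
      (hN _ hga _ hxa).eq, mul_inv_cancel_right]
  have hDn : Nat.card D ≤ n := by
    have hsub : (D : Set G) ⊆ Set.range fun g : G => ⁅g, a⁆ := by
      intro y hy
      obtain ⟨x, -, rfl⟩ := (hD y).1 hy
      exact ⟨x, rfl⟩
    rw [← SetLike.coe_sort_coe, Nat.card_coe_set_eq]
    exact (Set.ncard_le_ncard hsub (Set.toFinite _)).trans ((ncard_range_commutator a).le.trans ha)
  have hsurj := QuotientGroup.mk'_surjective D
  have hmap := map_commutatorWith hsurj a
  rw [card_eq_card_mul_card_map_mk hDle, hmap]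
  refine Nat.mul_le_mul hDn (card_commutatorWith_le_of_commute (X := QuotientGroup.mk' D '' X)
    ?_ ?_ ((ncard_conjugatesOf_map_le hsurj a).trans ha) ?_ ?_)
  · rw [← MonoidHom.map_closure, hX, Subgroup.map_top_of_surjective _ hsurj]
  · rintro _ ⟨x, hx, rfl⟩
    exact (ncard_conjugatesOf_map_le hsurj x).trans (hXn x hx)
  · rw [← hmap]
    rintro _ ⟨y, hy, rfl⟩ _ ⟨z, hz, rfl⟩
    exact (hN y hy z hz).map _
  · rw [← hmap]
    rintro _ ⟨y, hy, rfl⟩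
    rw [← commutatorElement_eq_one_iff_commute, ← map_commutatorElement]
    exact (QuotientGroup.eq_one_iff _).2 ((hD _).2 ⟨y, hy, rfl⟩)

/-- A bound for the order of `[G, a]` when `a` and the members of a generating set of `G` have at
most `n` conjugates each. -/
def commutatorWithBound (n : ℕ) : ℕ :=
  ((n * n) ^ n) ^ ((n * n) ^ n * ((n * n) ^ n * (n * n) ^ n) + 1) * (n * n ! ^ n)

/-- The centralizer of `N = [G, a]` has bounded index, since `N` is generated by `n` elements with
at most `n ^ 2` conjugates each. So `N'` is bounded by Schur's theorem, and `N / N'` is abelian. -/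
theorem card_commutatorWith_le {n : ℕ} {X : Set G} (hX : Subgroup.closure X = ⊤)
    (hXn : ∀ x ∈ X, (conjugatesOf x).ncard ≤ n) {a : G} (ha : (conjugatesOf a).ncard ≤ n) :
    Nat.card (commutatorWith a) ≤ commutatorWithBound n := by
  have hn : 0 < n := lt_of_lt_of_le
    ((Set.ncard_pos (Set.toFinite _)).2 ⟨a, mem_conjugatesOf_self⟩) ha
  set N := commutatorWith a
  have hcen : (Subgroup.center N).index ≤ (n * n) ^ n := by
    have h1 : (Subgroup.centralizer (N : Set G)).index ≤ (n * n) ^ n := by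
      refine index_centralizer_closure_le (Nat.mul_pos hn hn)
        ((ncard_range_commutator a).le.trans ha) ?_
      rintro _ ⟨g, rfl⟩
      exact (ncard_conjugatesOf_commutator_le g a).trans (Nat.mul_le_mul ha ha)
    have h2 : (Subgroup.centralizer (N : Set G)).subgroupOf N ≤ Subgroup.center N := by
      intro y hy
      rw [Subgroup.mem_center_iff]
      intro z
      exact Subtype.ext (hy z z.2)
    refine (Subgroup.index_antitone h2).trans (le_trans ?_ h1)
    exact relIndex_le_index _ _
  have hN' := card_commutator_le_of_index_center_le hcen
  set D : Subgroup G := ⁅N, N⁆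
  have hDcard : Nat.card D = Nat.card (commutator N) := by
    have : (commutator N).map N.subtype = D := by
      rw [commutator_def, Subgroup.map_commutator, ← MonoidHom.range_eq_map, Subgroup.range_subtype]
    rw [← this]
    exact Subgroup.card_map_of_injective N.subtype_injective
  have hDle : D ≤ N := Subgroup.commutator_le_left N N
  have hsurj := QuotientGroup.mk'_surjective D
  have hmap : N.map (QuotientGroup.mk' D) = _ := map_commutatorWith hsurj a
  rw [card_eq_card_mul_card_map_mk hDle, hmap, commutatorWithBound]
  refine Nat.mul_le_mul (hDcard.le.trans hN')
    (card_commutatorWith_le_of_comm (X := QuotientGroup.mk' D '' X)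
    ?_ ?_ ((ncard_conjugatesOf_map_le hsurj a).trans ha) ?_)
  · rw [← MonoidHom.map_closure, hX, Subgroup.map_top_of_surjective _ hsurj]
  · rintro _ ⟨x, hx, rfl⟩
    exact (ncard_conjugatesOf_map_le hsurj x).trans (hXn x hx)
  · rw [← hmap]
    rintro _ ⟨y, hy, rfl⟩ _ ⟨z, hz, rfl⟩
    rw [← commutatorElement_eq_one_iff_commute, ← map_commutatorElement]
    exact (QuotientGroup.eq_one_iff _).2 (Subgroup.commutator_mem_commutator hy hz)

end CommutatorsWithBound

/-! ### Bounded conjugacy classes on a subgroup -/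

section BoundedConjugacyClasses

open scoped commutatorElement

variable {G : Type*} [Group G]

theorem commutator_le_of_normalClosure_eq_top {K : Set G} (hK : Subgroup.normalClosure K = ⊤)
    {L : Subgroup G} [L.Normal] (h : ∀ k ∈ K, ∀ g : G, ⁅g, k⁆ ∈ L) : commutator G ≤ L := by
  have hZ : (⊤ : Subgroup G) ≤ (Subgroup.center (G ⧸ L)).comap (QuotientGroup.mk' L) := by
    rw [← hK]
    refine Subgroup.normalClosure_le_normal fun k hk => ?_
    refine Subgroup.mem_center_iff.2 fun g => ?_
    obtain ⟨g, rfl⟩ := QuotientGroup.mk'_surjective L g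
    refine commutatorElement_eq_one_iff_mul_comm.1 ?_
    rw [← map_commutatorElement]
    exact (QuotientGroup.eq_one_iff _).2 (h k hk g)
  rw [commutator_def, Subgroup.commutator_le]
  intro g _ k hk
  rw [← QuotientGroup.eq_one_iff]
  change QuotientGroup.mk' L ⁅g, k⁆ = 1
  rw [map_commutatorElement, commutatorElement_eq_one_iff_mul_comm]
  exact Subgroup.mem_center_iff.1 (hZ hk) _

variable [Finite G]

/-- A generating set `X` contains at most `|a ^ G|` elements generating a subgroup that is
transitive on the conjugates of `a`: as long as the orbit of `a` is not the whole class, some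
element of `X` moves it. -/
theorem exists_transitive_subset {X : Set G} (hX : Subgroup.closure X = ⊤) (a : G) :
    ∃ F ⊆ X, F.ncard ≤ (conjugatesOf a).ncard ∧
      ∀ y ∈ conjugatesOf a, ∃ b ∈ Subgroup.closure F, b * a * b⁻¹ = y := by
  let O : Set G → Set G := fun F => (fun b => b * a * b⁻¹) '' (Subgroup.closure F : Set G)
  have key : ∀ k : ℕ, ∃ F ⊆ X, F.ncard ≤ k ∧ (conjugatesOf a ⊆ O F ∨ k < (O F).ncard) := by
    intro k
    induction k with
    | zero =>
      refine ⟨∅, Set.empty_subset _, by simp, Or.inr ((Set.ncard_pos (Set.toFinite _)).2 ?_)⟩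
      exact ⟨a, 1, one_mem _, by simp⟩
    | succ k ih =>
      obtain ⟨F, hFX, hFk, hF⟩ := ih
      by_cases hgood : conjugatesOf a ⊆ O F
      · exact ⟨F, hFX, hFk.trans k.le_succ, Or.inl hgood⟩
      replace hF := hF.resolve_left hgood
      obtain ⟨x, hx, y, hy, hxy⟩ : ∃ x ∈ X, ∃ y ∈ O F, x * y * x⁻¹ ∉ O F := by
        by_contra! hcon
        refine hgood ?_
        rw [conjugatesOf_eq_range]
        rintro _ ⟨g, rfl⟩
        have hg : g ∈ Submonoid.closure X := by
          rw [← Subgroup.closure_toSubmonoid_of_finite, hX]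
          exact Subgroup.mem_top g
        have : ∀ y ∈ O F, g * y * g⁻¹ ∈ O F := by
          induction hg using Submonoid.closure_induction with
          | mem x hx => exact hcon x hx
          | one => simp
          | mul g h _ _ hg hh =>
            intro y hy
            have := hg _ (hh y hy)
            rwa [show g * (h * y * h⁻¹) * g⁻¹ = g * h * y * (g * h)⁻¹ by group] at this
        exact this a ⟨1, one_mem _, by simp⟩
      refine ⟨insert x F, Set.insert_subset hx hFX,
        (Set.ncard_insert_le x F).trans (Nat.succ_le_succ hFk), Or.inr ?_⟩
      have hle : Subgroup.closure F ≤ Subgroup.closure (insert x F) :=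
        Subgroup.closure_mono (Set.subset_insert x F)
      have hsub : insert (x * y * x⁻¹) (O F) ⊆ O (insert x F) := by
        refine Set.insert_subset ?_ (Set.image_mono hle)
        obtain ⟨b, hb, rfl⟩ := hy
        refine ⟨x * b, mul_mem (Subgroup.subset_closure (Set.mem_insert x F)) (hle hb), ?_⟩
        group
      have := Set.ncard_le_ncard hsub (Set.toFinite _)
      rw [Set.ncard_insert_of_notMem hxy (Set.toFinite _)] at this
      lia
  obtain ⟨F, hFX, hFk, hF⟩ := key (conjugatesOf a).ncard
  have hO : O F ⊆ conjugatesOf a := by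
    rw [conjugatesOf_eq_range]
    exact Set.image_subset_range _ _
  exact ⟨F, hFX, hFk, fun y hy => hF.resolve_right
    (Set.ncard_le_ncard hO (Set.toFinite _)).not_gt hy⟩

/-- Let `u` centralize a subgroup transitive on the class of `a`. Then the class of `u * a` contains
`u * a ^ G`, and equals it when it is no larger than the class of `a`; hence `[G, u] ≤ [G, a]`. -/
theorem commutator_mem_commutatorWith_of_centralizes {F : Set G} {a u : G}
    (hF : ∀ y ∈ conjugatesOf a, ∃ b ∈ Subgroup.closure F, b * a * b⁻¹ = y)
    (hu : u ∈ Subgroup.centralizer (Subgroup.closure F : Set G))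
    (hmax : (conjugatesOf (u * a)).ncard ≤ (conjugatesOf a).ncard) (g : G) :
    ⁅g, u⁆ ∈ commutatorWith a := by
  have hsub : (u * ·) '' conjugatesOf a ⊆ conjugatesOf (u * a) := by
    rintro _ ⟨y, hy, rfl⟩
    obtain ⟨b, hb, rfl⟩ := hF y hy
    rw [conjugatesOf_eq_range]
    refine ⟨b, ?_⟩
    change b * (u * a) * b⁻¹ = u * (b * a * b⁻¹)
    rw [← mul_assoc b u, hu b hb]
    group
  have heq := Set.eq_of_subset_of_ncard_le hsub
    (by rw [Set.ncard_image_of_injective _ (mul_right_injective u)]; exact hmax) (Set.toFinite _)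
  have hg : g * (u * a) * g⁻¹ ∈ conjugatesOf (u * a) := by
    rw [conjugatesOf_eq_range]
    exact ⟨g, rfl⟩
  rw [← heq, conjugatesOf_eq_range] at hg
  obtain ⟨_, ⟨h, rfl⟩, hh⟩ := hg
  have hh : u * (h * a * h⁻¹) = g * (u * a) * g⁻¹ := hh
  have h1 : ⁅g, u⁆ = u * (⁅h, a⁆ * ⁅g, a⁆⁻¹) * u⁻¹ := by
    calc ⁅g, u⁆ = g * (u * a) * g⁻¹ * (g * a * g⁻¹)⁻¹ * u⁻¹ := by
          simp only [commutatorElement_def]; group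
      _ = _ := by rw [← hh]; simp only [commutatorElement_def]; group
  rw [h1]
  exact (commutatorWith_normal a).conj_mem _ (mul_mem (commutator_mem_commutatorWith h a)
    (inv_mem (commutator_mem_commutatorWith g a))) u

theorem card_finset_sup_le {ι : Type*} (s : Finset ι) (f : ι → Subgroup G)
    (hf : ∀ i, (f i).Normal) {b : ℕ} (hb : ∀ i, Nat.card (f i) ≤ b) :
    Nat.card (s.sup f : Subgroup G) ≤ b ^ s.card := by
  classical
  induction s using Finset.induction_on with
  | empty => simp
  | insert i s hi ih =>
    rw [Finset.sup_insert, Finset.card_insert_of_notMem hi, sup_comm, pow_succ]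
    exact (card_sup_le_of_normal _ _).trans (Nat.mul_le_mul ih (hb i))

/-- A strengthening of Neumann's theorem on groups with bounded conjugacy classes: it is enough to
bound the classes of the elements of a subgroup whose normal closure is the whole group. -/
theorem card_commutator_le_of_normalClosure_eq_top {K : Subgroup G}
    (hK : Subgroup.normalClosure (K : Set G) = ⊤) {n : ℕ}
    (hn : ∀ x ∈ K, (conjugatesOf x).ncard ≤ n) :
    Nat.card (commutator G) ≤ commutatorWithBound n ^ n ^ n * commutatorWithBound n := by
  classical
  set X := Group.conjugatesOfSet (K : Set G)
  have hX : Subgroup.closure X = ⊤ := hK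
  have hXn : ∀ x ∈ X, (conjugatesOf x).ncard ≤ n := by
    intro x hx
    obtain ⟨k, hk, hkx⟩ := Group.mem_conjugatesOfSet_iff.1 hx
    rw [← hkx.conjugatesOf_eq]
    exact hn k hk
  obtain ⟨a, haK, hamax⟩ := Set.exists_max_image (K : Set G) (fun x => (conjugatesOf x).ncard)
    (Set.toFinite _) ⟨1, one_mem K⟩
  obtain ⟨F, hFX, hFcard, hF⟩ := exists_transitive_subset hX a
  have hnpos : 0 < n := lt_of_lt_of_le
    ((Set.ncard_pos (Set.toFinite _)).2 ⟨a, mem_conjugatesOf_self⟩) (hn a haK)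
  -- By the choice of `a`, commutators with elements of `K ⊓ U` lie in `[G, a]`, so `G'` lies in the
  -- product of `[G, a]` and the `[G, r]`, for `r` in a transversal of `K ⊓ U` in `K`.
  set U := Subgroup.centralizer (Subgroup.closure F : Set G)
  have hU : U.index ≤ n ^ n :=
    index_centralizer_closure_le hnpos (hFcard.trans (hn a haK)) fun s hs => hXn s (hFX hs)
  have hb : ∀ k : K, Nat.card (commutatorWith (k : G)) ≤ commutatorWithBound n :=
    fun k => card_commutatorWith_le hX hXn (hn k k.2)
  have := Fintype.ofFinite (K ⧸ U.subgroupOf K)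
  let f : K ⧸ U.subgroupOf K → Subgroup G := fun q => commutatorWith (q.out : G)
  have hcard : Fintype.card (K ⧸ U.subgroupOf K) ≤ n ^ n := by
    rw [← Nat.card_eq_fintype_card]
    exact (relIndex_le_index _ _).trans hU
  have hsup : (Finset.univ.sup f).Normal := by
    rw [Finset.sup_univ_eq_iSup]
    infer_instance
  have hle : commutator G ≤ Finset.univ.sup f ⊔ commutatorWith a := by
    refine commutator_le_of_normalClosure_eq_top hK fun k hk g => ?_
    set q : K ⧸ U.subgroupOf K := QuotientGroup.mk ⟨k, hk⟩ with hq
    have hu : (q.out)⁻¹ * ⟨k, hk⟩ ∈ U.subgroupOf K := QuotientGroup.eq.1 (Quotient.out_eq' q)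
    set r : K := q.out
    obtain ⟨u, huK, huU, hk'⟩ : ∃ u ∈ K, u ∈ U ∧ k = r * u :=
      ⟨(r : G)⁻¹ * k, mul_mem (inv_mem r.2) hk, hu, by group⟩
    have h1 : ⁅g, u⁆ ∈ commutatorWith a := commutator_mem_commutatorWith_of_centralizes hF huU
      (hamax _ (mul_mem huK haK)) g
    have h2 : ⁅g, k⁆ = ⁅g, (r : G)⁆ * (r * ⁅g, u⁆ * (r : G)⁻¹) := by
      rw [hk']
      simp only [commutatorElement_def]; group
    have h3 : f q ≤ Finset.univ.sup f := Finset.le_sup (Finset.mem_univ q)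
    rw [h2]
    exact mul_mem ((h3.trans le_sup_left) (commutator_mem_commutatorWith g _))
      (le_sup_right (a := Finset.univ.sup f)
        ((commutatorWith_normal a).conj_mem _ h1 _))
  have hbpos : 0 < commutatorWithBound n := lt_of_lt_of_le Nat.card_pos (hb 1)
  calc Nat.card (commutator G) ≤ Nat.card (Finset.univ.sup f ⊔ commutatorWith a : Subgroup G) :=
        Subgroup.card_le_of_le hle
    _ ≤ Nat.card (Finset.univ.sup f : Subgroup G) * Nat.card (commutatorWith a) :=
        card_sup_le_of_normal _ _
    _ ≤ commutatorWithBound n ^ n ^ n * commutatorWithBound n :=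
        Nat.mul_le_mul ((card_finset_sup_le _ f (fun q => commutatorWith_normal _)
          fun q => hb q.out).trans (Nat.pow_le_pow_right hbpos hcard)) (hb ⟨a, haK⟩)

end BoundedConjugacyClasses

/-! ### Normalizers of Hall subgroups -/

section HallSubgroups

universe u

open MulAction in
/-- A complement `K` of an abelian normal subgroup `A` is a left transversal of `A`, and when the
orders are coprime it is the whole stabilizer of its class in `A.QuotientDiff`. As `A` is transitive
on these classes, all complements are conjugate. -/
theorem exists_conj_eq_of_isComplement' {R : Type*} [Group R] [Finite R] {A K₁ K₂ : Subgroup R}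
    [A.Normal] [IsMulCommutative A] (hA : Nat.Coprime (Nat.card A) A.index)
    (h₁ : K₁.IsComplement' A) (h₂ : K₂.IsComplement' A) :
    ∃ a ∈ A, K₁.map (MulAut.conj a).toMonoidHom = K₂ := by
  have key : ∀ K : Subgroup R, K.IsComplement' A →
      ∃ q : A.QuotientDiff, K = stabilizer R q := by
    intro K hK
    let α : A.LeftTransversal := ⟨K, hK⟩
    let q : A.QuotientDiff := Quotient.mk'' α
    refine ⟨q, ?_⟩
    have hle : K ≤ stabilizer R q := by
      intro k hk
      have : MulOpposite.op k⁻¹ • α = α := by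
        refine Subtype.ext ?_
        change MulOpposite.op k⁻¹ • (K : Set R) = K
        exact op_smul_coe_set (inv_mem hk)
      change (Quotient.mk'' (MulOpposite.op k⁻¹ • α) : A.QuotientDiff) = Quotient.mk'' α
      rw [this]
    refine Subgroup.eq_of_le_of_card_ge hle ?_
    have hst := Subgroup.isComplement'_stabilizer_of_coprime (α := q) hA
    exact (Nat.eq_of_mul_eq_mul_left Nat.card_pos
      (hst.card_mul_card.trans (hK.symm.card_mul_card).symm)).le
  obtain ⟨q₁, hq₁⟩ := key K₁ h₁
  obtain ⟨q₂, hq₂⟩ := key K₂ h₂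
  obtain ⟨a, ha⟩ := Subgroup.exists_smul_eq hA q₁ q₂
  have ha' : (a : R) • q₁ = q₂ := ha
  refine ⟨a, a.2, ?_⟩
  rw [hq₁, hq₂, ← ha', stabilizer_smul_eq_stabilizer_map_conj]

/-- Two subgroups of the same order which have the same join with an abelian normal subgroup of
coprime order are conjugate. -/
theorem exists_conj_eq_of_sup_eq {G : Type*} [Group G] [Finite G] {A Q₁ Q₂ : Subgroup G}
    [A.Normal] [IsMulCommutative A] (hcop : Nat.Coprime (Nat.card Q₁) (Nat.card A))
    (hcard : Nat.card Q₁ = Nat.card Q₂) (hsup : Q₁ ⊔ A = Q₂ ⊔ A) :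
    ∃ a ∈ A, Q₁.map (MulAut.conj a).toMonoidHom = Q₂ := by
  set R := Q₁ ⊔ A with hR
  have hQ₁ : Q₁ ≤ R := le_sup_left
  have hQ₂ : Q₂ ≤ R := hsup ▸ le_sup_left
  have hAR : A ≤ R := le_sup_right
  have hcR : Nat.card R = Nat.card Q₁ * Nat.card A := by
    have h1 := Subgroup.relIndex_mul_relIndex ⊥ A R bot_le hAR
    have h3 : A.relIndex R = Nat.card Q₁ := by
      rw [hR, Subgroup.relIndex_sup_right, ← Subgroup.inf_relIndex_right, inf_comm,
        (Subgroup.disjoint_of_coprime_natCard hcop).eq_bot, Subgroup.relIndex_bot_left]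
    rw [← Subgroup.relIndex_bot_left R, ← h1, h3, Subgroup.relIndex_bot_left, mul_comm]
  have hcard_sub : ∀ H : Subgroup G, H ≤ R → Nat.card (H.subgroupOf R) = Nat.card H :=
    fun H hH => Nat.card_congr (Subgroup.subgroupOfEquivOfLe hH).toEquiv
  have hcompl : ∀ Q ≤ R, Nat.card Q = Nat.card Q₁ →
      (Q.subgroupOf R).IsComplement' (A.subgroupOf R) := by
    intro Q hQ hQc
    refine Subgroup.isComplement'_of_coprime ?_ ?_
    · rw [hcard_sub Q hQ, hcard_sub A hAR, hQc, hcR]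
    · rwa [hcard_sub Q hQ, hcard_sub A hAR, hQc]
  have hidx : Nat.Coprime (Nat.card (A.subgroupOf R)) (A.subgroupOf R).index := by
    rw [(hcompl Q₁ hQ₁ rfl).index_eq_card, hcard_sub Q₁ hQ₁, hcard_sub A hAR]
    exact hcop.symm
  obtain ⟨a, ha, haQ⟩ := exists_conj_eq_of_isComplement' hidx (hcompl Q₁ hQ₁ rfl)
    (hcompl Q₂ hQ₂ hcard.symm)
  refine ⟨a, ha, ?_⟩
  have h := congrArg (Subgroup.map R.subtype) haQ
  rw [Subgroup.map_subgroupOf_eq_of_le hQ₂, Subgroup.map_map] at h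
  rw [← h]
  nth_rw 1 [← Subgroup.map_subgroupOf_eq_of_le hQ₁]
  rw [Subgroup.map_map]
  rfl

/-- A nontrivial solvable normal subgroup of a finite group contains a nontrivial abelian normal
subgroup that is a `p`-group or has order prime to `p`. -/
theorem exists_comm_normal_le {G : Type*} [Group G] [Finite G] [Group.IsSolvable G]
    (p : ℕ) [Fact p.Prime] {M : Subgroup G} [M.Normal] (hM : M ≠ ⊥) :
    ∃ A ≤ M, A.Normal ∧ A ≠ ⊥ ∧ IsMulCommutative A ∧
      (IsPGroup p A ∨ (Nat.card A).Coprime p) := by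
  obtain ⟨A, ⟨hAn, hAb, hAM⟩, hmin⟩ := Set.Finite.exists_minimal
    (Set.toFinite {A : Subgroup G | A.Normal ∧ A ≠ ⊥ ∧ A ≤ M}) ⟨M, inferInstance, hM, le_rfl⟩
  have hcomm : IsMulCommutative A := by
    have hlt := Group.IsSolvable.commutator_lt_of_ne_bot hAb
    have hbot : ⁅A, A⁆ = ⊥ := by
      by_contra hne
      exact hlt.not_ge (hmin ⟨inferInstance, hne, hlt.le.trans hAM⟩ hlt.le)
    refine ⟨⟨fun x y => Subtype.ext ?_⟩⟩
    exact (Subgroup.mem_centralizer_iff.1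
      (Subgroup.commutator_eq_bot_iff_le_centralizer.1 hbot x.2) y y.2).symm
  refine ⟨A, hAM, hAn, hAb, hcomm, ?_⟩
  obtain ⟨S⟩ : Nonempty (Sylow p A) := inferInstance
  have hSn : (S : Subgroup A).Normal :=
    ⟨fun x hx g => by rwa [mul_comm' g x, mul_inv_cancel_right]⟩
  have := S.characteristic_of_normal hSn
  by_cases hS : (S : Subgroup A) = ⊥
  · right
    have h := S.not_dvd_index
    rw [hS, Subgroup.index_bot] at h
    exact ((Nat.Prime.coprime_iff_not_dvd Fact.out).2 h).symm
  · left
    have hne : (S : Subgroup A).map A.subtype ≠ ⊥ := by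
      rwa [Ne, Subgroup.map_eq_bot_iff_of_injective _ A.subtype_injective]
    have hle : (S : Subgroup A).map A.subtype ≤ A := Subgroup.map_subtype_le _
    have heq := le_antisymm hle (hmin ⟨inferInstance, hne, hle.trans hAM⟩ hle)
    rw [← heq]
    exact S.isPGroup'.map _

theorem le_of_coprime_card_of_index_dvd {G : Type*} [Group G] [Finite G] {p k : ℕ}
    {A Q : Subgroup G} [A.Normal] (hA : (Nat.card A).Coprime p) (hQ : (Nat.card Q).Coprime p)
    (hidx : Q.index ∣ p ^ k) : A ≤ Q := by
  have h1 : Nat.card (Q ⊔ A : Subgroup G) ∣ Nat.card A * Nat.card Q := by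
    rw [← Subgroup.relIndex_bot_left (Q ⊔ A),
      ← Subgroup.relIndex_mul_relIndex ⊥ A (Q ⊔ A) bot_le le_sup_right,
      Subgroup.relIndex_sup_right, Subgroup.relIndex_bot_left]
    refine Nat.mul_dvd_mul_left _ ?_
    rw [← Subgroup.relIndex_bot_left Q]
    exact Subgroup.relIndex_dvd_of_le_left _ bot_le
  have h2 : Q.relIndex (Q ⊔ A) ∣ p ^ k :=
    (Subgroup.relIndex_dvd_index_of_le le_sup_left).trans hidx
  have h3 : Q.relIndex (Q ⊔ A) ∣ Nat.card A * Nat.card Q :=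
    (Subgroup.relIndex_dvd_card _ _).trans h1
  have h4 : Q.relIndex (Q ⊔ A) = 1 :=
    Nat.eq_one_of_dvd_coprimes ((hA.mul_left hQ).pow_right k) h3 h2
  exact le_sup_right.trans (Subgroup.relIndex_eq_one.1 h4)

/-- A Frattini-type statement: if a Hall `p'`-subgroup `Q` of a finite solvable group lies in a
proper normal subgroup `M`, then its normalizer does not. It would follow from the conjugacy of
the Hall subgroups of `M`; the induction here only needs conjugacy of the complements of an abelian
normal `p`-subgroup. -/
theorem not_normalizer_le_of_hall (p : ℕ) [Fact p.Prime] (n : ℕ) :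
    ∀ (G : Type u) [Group G] [Finite G] [Group.IsSolvable G], Nat.card G ≤ n →
      ∀ (Q M : Subgroup G) (k : ℕ), M.Normal → M ≠ ⊤ → Q ≤ M → (Nat.card Q).Coprime p →
        Q.index ∣ p ^ k → ¬ Subgroup.normalizer (Q : Set G) ≤ M := by
  induction n with
  | zero => exact fun G _ _ _ h => absurd h (Nat.card_pos (α := G)).not_ge
  | succ n ih =>
    intro G _ _ _ hG Q M k hMn hM hQM hcop hidx hle
    by_cases hMb : M = ⊥
    · have hQ : Q = ⊥ := le_bot_iff.1 (hQM.trans hMb.le)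
      refine hM (top_le_iff.1 (le_trans ?_ hle))
      rw [hQ, Subgroup.normalizer_eq_top]
    obtain ⟨A, hAM, hAn, hAb, hAc, hAp⟩ := exists_comm_normal_le p hMb
    set f := QuotientGroup.mk' A
    have hf : Function.Surjective f := QuotientGroup.mk'_surjective A
    have hker : f.ker = A := QuotientGroup.ker_mk' A
    have hGA : Nat.card (G ⧸ A) ≤ n := by
      have h1 := Subgroup.card_eq_card_quotient_mul_card_subgroup A
      have h2 : 1 < Nat.card A := A.one_lt_card_iff_ne_bot.2 hAb
      have h3 : 0 < Nat.card (G ⧸ A) := Nat.card_pos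
      have h4 : Nat.card (G ⧸ A) * 2 ≤ Nat.card (G ⧸ A) * Nat.card A := Nat.mul_le_mul_left _ h2
      lia
    have hR : ¬ Subgroup.normalizer ((Q ⊔ A : Subgroup G) : Set G) ≤ M := by
      intro hRM
      have : Group.IsSolvable (G ⧸ A) := Group.isSolvable_of_surjective hf
      refine ih (G ⧸ A) hGA (Q.map f) (M.map f) k (hMn.map f hf) ?_ (Subgroup.map_mono hQM)
        (hcop.coprime_dvd_left (Subgroup.card_map_dvd Q f))
        ((Subgroup.index_map_dvd Q hf).trans hidx) ?_
      · intro h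
        refine hM ?_
        rw [← Subgroup.comap_map_eq_self (hker.le.trans hAM), h, Subgroup.comap_top]
      · rw [← Subgroup.map_comap_eq_self_of_surjective hf (Subgroup.normalizer _)]
        refine Subgroup.map_mono ?_
        rw [Subgroup.comap_normalizer_eq_of_le_range
          ((MonoidHom.range_eq_top.2 hf).symm ▸ le_top), Subgroup.comap_map_eq, hker]
        exact hRM
    obtain hAp | hAp := hAp
    · -- `x` normalizes `Q ⊔ A`, so `Q` and its conjugate by `x` are complements of `A` in `Q ⊔ A`;
      -- correcting `x` by an element of `A ≤ M` makes it normalize `Q`.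
      refine hR fun x hx => ?_
      have hAcop : (Nat.card Q).Coprime (Nat.card A) := by
        obtain ⟨m, hm⟩ := (IsPGroup.iff_card).1 hAp
        rw [hm]
        exact hcop.pow_right m
      have hxQ : (Q.map (MulAut.conj x).toMonoidHom) ⊔ A = Q ⊔ A := by
        have h := Subgroup.mem_normalizer_iff_map_conj_eq.1 hx
        have hA := Subgroup.Normal.map_conj_eq A x
        rw [Subgroup.map_sup, hA] at h
        exact h
      obtain ⟨a, ha, haQ⟩ := exists_conj_eq_of_sup_eq (Q₂ := Q.map (MulAut.conj x).toMonoidHom)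
        hAcop (Subgroup.card_map_of_injective (MulAut.conj x).injective).symm hxQ.symm
      have hax : a⁻¹ * x ∈ Subgroup.normalizer (Q : Set G) := by
        rw [Subgroup.mem_normalizer_iff_map_conj_eq]
        have h : (MulAut.conj (a⁻¹ * x)).toMonoidHom =
            (MulAut.conj a⁻¹).toMonoidHom.comp (MulAut.conj x).toMonoidHom := by
          ext y; simp [mul_assoc]
        change Q.map (MulAut.conj (a⁻¹ * x)).toMonoidHom = Q
        rw [h, ← Subgroup.map_map, ← haQ, Subgroup.map_map]
        convert Subgroup.map_id Q
        ext y; simp [mul_assoc]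
      have := mul_mem (hAM ha) (hle hax)
      rwa [mul_inv_cancel_left] at this
    · -- Here `A ≤ Q`, so that `Q ⊔ A = Q`.
      rw [sup_eq_left.2 (le_of_coprime_card_of_index_dvd hAp hcop hidx)] at hR
      exact hR hle

end HallSubgroups

/-! ### System normalizers -/

section SystemNormalizers

variable {G : Type*} [Group G]

theorem coe_sup_eq_mul_of_permutable {H K : Subgroup G}
    (h : (H : Set G) * (K : Set G) = (K : Set G) * (H : Set G)) :
    ((H ⊔ K : Subgroup G) : Set G) = (H : Set G) * (K : Set G) := by
  let L : Subgroup G :=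
    { carrier := (H : Set G) * (K : Set G)
      mul_mem' := by
        intro x y hx hy
        have hxy : x * y ∈ (H : Set G) * K * (H * K) := Set.mul_mem_mul hx hy
        rwa [mul_assoc, ← mul_assoc (K : Set G), ← h, mul_assoc (H : Set G), ← mul_assoc (H : Set G),
          coe_mul_coe, coe_mul_coe] at hxy
      one_mem' := ⟨1, one_mem H, 1, one_mem K, one_mul 1⟩
      inv_mem' := by
        intro x hx
        have : x⁻¹ ∈ ((H : Set G) * K)⁻¹ := Set.inv_mem_inv.2 hx
        rwa [mul_inv_rev, inv_coe_set, inv_coe_set, ← h] at this }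
  refine Set.Subset.antisymm ?_ ?_
  · have h1 : H ≤ L := fun x hx => ⟨x, hx, 1, one_mem K, mul_one x⟩
    have h2 : K ≤ L := fun x hx => ⟨1, one_mem H, x, hx, one_mul x⟩
    exact sup_le h1 h2
  · rintro _ ⟨x, hx, y, hy, rfl⟩
    exact mul_mem (le_sup_left (a := H) (b := K) hx) (le_sup_right (a := H) (b := K) hy)

theorem card_sup_of_permutable_of_coprime {H K : Subgroup G}
    (h : (H : Set G) * (K : Set G) = (K : Set G) * (H : Set G))
    (hcop : (Nat.card H).Coprime (Nat.card K)) :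
    Nat.card (H ⊔ K : Subgroup G) = Nat.card H * Nat.card K := by
  rw [← Nat.card_prod, ← SetLike.coe_sort_coe, coe_sup_eq_mul_of_permutable h]
  symm
  refine Nat.card_congr (Equiv.ofBijective (fun x : H × K =>
    (⟨x.1 * x.2, Set.mul_mem_mul x.1.2 x.2.2⟩ : ((H : Set G) * (K : Set G) : Set G))) ⟨?_, ?_⟩)
  · intro x y hxy
    exact Subgroup.mul_injective_of_disjoint (Subgroup.disjoint_of_coprime_natCard hcop)
      (congrArg Subtype.val hxy)
  · rintro ⟨_, x, hx, y, hy, rfl⟩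
    exact ⟨(⟨x, hx⟩, ⟨y, hy⟩), rfl⟩

theorem coprime_prod_primeFactors_pow {m : ℕ} {s : Finset m.primeFactors} {p : m.primeFactors}
    (hp : p ∉ s) (e : ℕ → ℕ) : (∏ q ∈ s, (q : ℕ) ^ e q).Coprime p := by
  refine Nat.Coprime.prod_left fun q hq => Nat.Coprime.pow_left _ ?_
  refine (Nat.coprime_primes (Nat.prime_of_mem_primeFactors q.2)
    (Nat.prime_of_mem_primeFactors p.2)).2 fun h => hp ?_
  rwa [← Subtype.ext h]

namespace SylowBasis

/-- The subgroup generated by the members of a Sylow basis belonging to the primes in `s`. It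
is a Hall subgroup of `G` for these primes. -/
def hall (B : SylowBasis G) (s : Finset (Nat.card G).primeFactors) : Subgroup G :=
  s.sup fun p => (B.sylow p : Subgroup G)

theorem sylow_le_hall (B : SylowBasis G) {s : Finset (Nat.card G).primeFactors}
    {p : (Nat.card G).primeFactors} (hp : p ∈ s) : (B.sylow p : Subgroup G) ≤ B.hall s :=
  Finset.le_sup (f := fun p => (B.sylow p : Subgroup G)) hp

variable [Finite G]

theorem card_sylow (B : SylowBasis G) (p : (Nat.card G).primeFactors) :
    Nat.card (B.sylow p : Subgroup G) = (p : ℕ) ^ (Nat.card G).factorization p := by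
  have : Fact (p : ℕ).Prime := ⟨Nat.prime_of_mem_primeFactors p.2⟩
  exact (B.sylow p).card_eq_multiplicity

theorem card_hall_and_permutable (B : SylowBasis G) (s : Finset (Nat.card G).primeFactors) :
    Nat.card (B.hall s) = ∏ q ∈ s, (q : ℕ) ^ (Nat.card G).factorization q ∧
      ∀ p, (B.hall s : Set G) * ((B.sylow p : Subgroup G) : Set G) =
        ((B.sylow p : Subgroup G) : Set G) * (B.hall s : Set G) := by
  classical
  induction s using Finset.induction_on with
  | empty => simp [hall]
  | insert i s hi ih =>
    obtain ⟨hcard, hperm⟩ := ih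
    have hins : B.hall (insert i s) = B.hall s ⊔ (B.sylow i : Subgroup G) := by
      rw [hall, Finset.sup_insert, sup_comm]
      rfl
    rw [hins]
    refine ⟨?_, fun p => ?_⟩
    · rw [card_sup_of_permutable_of_coprime (hperm i), hcard, B.card_sylow,
        Finset.prod_insert hi, mul_comm]
      rw [hcard, B.card_sylow]
      exact (coprime_prod_primeFactors_pow hi _).pow_right _
    · have hip : ((B.sylow i : Subgroup G) : Set G) * ((B.sylow p : Subgroup G) : Set G) =
        ((B.sylow p : Subgroup G) : Set G) * ((B.sylow i : Subgroup G) : Set G) :=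
        B.permutable i p
      rw [coe_sup_eq_mul_of_permutable (hperm i), mul_assoc, hip, ← mul_assoc, hperm p, mul_assoc]

theorem card_hall (B : SylowBasis G) (s : Finset (Nat.card G).primeFactors) :
    Nat.card (B.hall s) = ∏ q ∈ s, (q : ℕ) ^ (Nat.card G).factorization q :=
  (B.card_hall_and_permutable s).1

theorem hall_permutable (B : SylowBasis G) (s : Finset (Nat.card G).primeFactors)
    (p : (Nat.card G).primeFactors) :
    (B.hall s : Set G) * ((B.sylow p : Subgroup G) : Set G) =
      ((B.sylow p : Subgroup G) : Set G) * (B.hall s : Set G) :=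
  (B.card_hall_and_permutable s).2 p

theorem coprime_card_hall (B : SylowBasis G) {s : Finset (Nat.card G).primeFactors}
    {p : (Nat.card G).primeFactors} (hp : p ∉ s) : (Nat.card (B.hall s)).Coprime p := by
  rw [card_hall]
  exact coprime_prod_primeFactors_pow hp _

theorem disjoint_hall_sylow (B : SylowBasis G) {s : Finset (Nat.card G).primeFactors}
    {p : (Nat.card G).primeFactors} (hp : p ∉ s) :
    Disjoint (B.hall s) (B.sylow p : Subgroup G) := by
  refine Subgroup.disjoint_of_coprime_natCard ?_
  rw [card_sylow]
  exact (B.coprime_card_hall hp).pow_right _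

theorem card_hall_compl_mul (B : SylowBasis G) (p : (Nat.card G).primeFactors) :
    Nat.card (B.hall {p}ᶜ) * (p : ℕ) ^ (Nat.card G).factorization p = Nat.card G := by
  have h := Nat.prod_factorization_pow_eq_self (n := Nat.card G) Nat.card_pos.ne'
  rw [Finsupp.prod, Nat.support_factorization, ← Finset.prod_coe_sort] at h
  rw [card_hall, mul_comm, ← Finset.prod_singleton
    (fun q : (Nat.card G).primeFactors => (q : ℕ) ^ (Nat.card G).factorization q) p,
    Finset.prod_mul_prod_compl]
  exact h

theorem hall_compl_mul_sylow (B : SylowBasis G) (p : (Nat.card G).primeFactors) :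
    (B.hall {p}ᶜ : Set G) * ((B.sylow p : Subgroup G) : Set G) = Set.univ := by
  rw [← coe_sup_eq_mul_of_permutable (B.hall_permutable _ p)]
  have h : B.hall {p}ᶜ ⊔ (B.sylow p : Subgroup G) = ⊤ := by
    refine Subgroup.eq_top_of_card_eq _ ?_
    rw [card_sup_of_permutable_of_coprime (B.hall_permutable _ p), card_sylow,
      B.card_hall_compl_mul p]
    rw [card_sylow]
    exact (B.coprime_card_hall (by simp)).pow_right _
  rw [h]
  rfl

/-- An element `y` of `P_p` that normalizes the product `Q` of the other members of the basis
normalizes each of them, since `P_q = Q ∩ P_q P_p` for `q ≠ p`. -/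
theorem mem_systemNormalizer_of_mem_normalizer_hall (B : SylowBasis G)
    (p : (Nat.card G).primeFactors) {y : G} (hy : y ∈ (B.sylow p : Subgroup G))
    (hyQ : y ∈ Subgroup.normalizer (B.hall {p}ᶜ : Set G)) : y ∈ B.systemNormalizer := by
  refine Subgroup.mem_iInf.2 fun q => ?_
  by_cases hqp : q = p
  · subst hqp
    exact Subgroup.le_normalizer (H := (B.sylow q : Subgroup G)) hy
  have hqmem : q ∈ ({p}ᶜ : Finset _) := by simpa using hqp
  set Q := B.hall {p}ᶜ
  have key : (B.sylow p : Subgroup G) ⊓ Subgroup.normalizer (Q : Set G) ≤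
      Subgroup.normalizer ((B.sylow q : Subgroup G) : Set G) := by
    refine Subgroup.le_normalizer_iff.2 ?_
    rintro y ⟨hy, hyQ⟩ z hz
    have hzQ : z ∈ Q := B.sylow_le_hall hqmem hz
    have h1 : y * z * y⁻¹ ∈ Q := (Subgroup.mem_normalizer_iff.1 hyQ z).1 hzQ
    have h2 : y * z * y⁻¹ ∈ ((B.sylow q : Subgroup G) ⊔ (B.sylow p : Subgroup G) : Subgroup G) :=
      mul_mem (mul_mem (Subgroup.mem_sup_right hy) (Subgroup.mem_sup_left hz))
        (inv_mem (Subgroup.mem_sup_right hy))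
    rw [← SetLike.mem_coe, coe_sup_eq_mul_of_permutable (B.permutable q p)] at h2
    obtain ⟨a, ha, b, hb, hab⟩ := h2
    have hab : a * b = y * z * y⁻¹ := hab
    have hbQ : b ∈ Q := by
      have := mul_mem (inv_mem (B.sylow_le_hall hqmem ha)) (hab ▸ h1)
      rwa [inv_mul_cancel_left] at this
    have hb1 : b = 1 := by
      have hd := B.disjoint_hall_sylow (s := {p}ᶜ) (p := p) (by simp)
      exact Subgroup.disjoint_def.1 hd hbQ hb
    rw [← hab, hb1, mul_one]
    exact ha
  exact key ⟨hy, hyQ⟩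

/-- Suppose that the normal closure `N` of the system normalizer is proper. For a prime `p` dividing
the index of `N G'`, the Hall `p'`-subgroup `Q` of the basis generates with `N G'` a proper
normal subgroup `M`. As `G = Q P_p`, an element of the normalizer of `Q` outside `M` can be chosen
in `P_p`, and then lies in the system normalizer, hence in `N ≤ M`. -/
theorem normalClosure_systemNormalizer [Group.IsSolvable G] (B : SylowBasis G) :
    Subgroup.normalClosure (B.systemNormalizer : Set G) = ⊤ := by
  set N := Subgroup.normalClosure (B.systemNormalizer : Set G)
  by_contra hN
  set D := N ⊔ commutator G with hD_def
  have hD : D ≠ ⊤ := by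
    intro hD
    have hf : Function.Surjective (QuotientGroup.mk' N) := QuotientGroup.mk'_surjective N
    have : Group.IsSolvable (G ⧸ N) := Group.isSolvable_of_surjective hf
    have : Nontrivial (G ⧸ N) := QuotientGroup.nontrivial_iff.2 hN
    refine (Group.IsSolvable.commutator_lt_top_of_nontrivial (G ⧸ N)).ne ?_
    have h := congrArg (Subgroup.map (QuotientGroup.mk' N)) hD
    rw [hD_def, Subgroup.map_sup, QuotientGroup.map_mk'_self, bot_sup_eq, commutator_def,
      Subgroup.map_commutator, Subgroup.map_top_of_surjective _ hf] at h
    exact h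
  obtain ⟨p, hp, hpD⟩ := Nat.exists_prime_and_dvd (mt Subgroup.index_eq_one.1 hD)
  have : Fact p.Prime := ⟨hp⟩
  let p' : (Nat.card G).primeFactors := ⟨p, Nat.mem_primeFactors.2
    ⟨hp, hpD.trans D.index_dvd_card, Nat.card_pos.ne'⟩⟩
  set Q := B.hall {p'}ᶜ
  have hQcop : (Nat.card Q).Coprime p := B.coprime_card_hall (p := p') (by simp)
  have hMtop : D ⊔ Q ≠ ⊤ := by
    intro h
    have h1 : D.index ∣ Nat.card Q := by
      rw [← Subgroup.relIndex_top_right, ← h, Subgroup.relIndex_sup_left]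
      exact Subgroup.relIndex_dvd_card _ _
    exact hp.one_lt.ne' (Nat.eq_one_of_dvd_coprimes hQcop (hpD.trans h1) dvd_rfl)
  have hM : (D ⊔ Q).Normal := by
    refine ⟨fun x hx g => ?_⟩
    have h : g * x * g⁻¹ * x⁻¹ ∈ D ⊔ Q := by
      refine le_sup_left (a := D) (le_sup_right (a := N) ?_)
      exact Subgroup.commutator_mem_commutator (Subgroup.mem_top g) (Subgroup.mem_top x)
    simpa using mul_mem h hx
  have hidx : Q.index ∣ p ^ (Nat.card G).factorization p := by
    have h1 := B.card_hall_compl_mul p'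
    have h2 := Q.card_mul_index
    exact (Nat.eq_of_mul_eq_mul_left Nat.card_pos (h2.trans h1.symm)).dvd
  refine not_normalizer_le_of_hall p (Nat.card G) G le_rfl Q (D ⊔ Q) _ hM hMtop le_sup_right
    hQcop hidx fun x hx => ?_
  obtain ⟨a, ha, y, hy, rfl⟩ := (B.hall_compl_mul_sylow p').symm ▸ Set.mem_univ x
  have hyQ : y ∈ Subgroup.normalizer (Q : Set G) := by
    have := mul_mem (inv_mem (Subgroup.le_normalizer ha)) hx
    rwa [inv_mul_cancel_left] at this
  have hyT := B.mem_systemNormalizer_of_mem_normalizer_hall p' hy hyQ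
  exact mul_mem (le_sup_right (a := D) ha)
    (le_sup_left (a := D) (le_sup_left (a := N) (Subgroup.subset_normalClosure hyT)))

end SylowBasis

end SystemNormalizers

theorem corollary3p2 :
    ∃ f : ℕ → ℕ, ∀ n : ℕ, 0 < n →
      ∀ (G : Type*) [Group G] [Finite G], Group.IsSolvable G → ∀ T : Subgroup G,
        IsSystemNormalizer T → (∀ x ∈ T, (conjugatesOf x).ncard ≤ n) →
          Nat.card (commutator G) ≤ f n := by
  refine ⟨fun n => commutatorWithBound n ^ n ^ n * commutatorWithBound n, ?_⟩
  rintro n - G _ _ hG _ ⟨B, rfl⟩ hT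
  exact card_commutator_le_of_normalClosure_eq_top B.normalClosure_systemNormalizer hT
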